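/- Let $\mathbb{S}^2\subset\mathbb{R}^3$ be the unit sphere with the Euclidean metric, and let $\mathbb{C}=\coprod_{p\in\mathbb{S}^2}\mathbb{L}^2([0,1],T_p(\mathbb{S}^2))$ be the vector bundle over $\mathbb{S}^2$ with the Riemannian metric $\langle (u_1,w_1),(u_2,w_2)\rangle=u_1\cdot u_2+\int_0^1 w_1(t)\cdot w_2(t)\,dt$ on $T_{(x,v)}(\mathbb{C})\cong T_x(\mathbb{S}^2)\oplus \mathbb{L}^2([0,1],T_x(\mathbb{S}^2))$. The velocity of a smooth path $(\beta(s),q(s,\cdot))$, $s\in[0,1]$, in $\mathbb{C}$ is $(\dot\beta(s),\nabla_{\dot\beta(s)}q(s,\cdot))$, where $\nabla$ is covariant differentiation on $\mathbb{S}^2$ along $\beta$, so that its length is $\int_0^1\bigl(|\dot\beta(s)|^2+\int_0^1|\nabla_{\dot\beta(s)}q(s,t)|^2dt\bigr)^{1/2}ds$. Such a path is called a geodesic if it is a shortest one among all smooth paths in $\mathbb{C}$ with the same endpoints $(p_1,q_1)$, $(p_2,q_2)$. Given a linear isometric map $\mathcal{T}:T_{p_1}(\mathbb{S}^2)\to T_{p_2}(\mathbb{S}^2)$,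 a smooth curve $\beta:[0,1]\to\mathbb{S}^2$ from $p_1$ to $p_2$ is called $p$-optimal (for $\mathcal T$) if (1) the parallel transport map along $\beta$ from $T_{p_1}(\mathbb{S}^2)$ to $T_{p_2}(\mathbb{S}^2)$ equals $\mathcal{T}$, and (2) $\beta$ is a shortest one among all smooth curves on $\mathbb{S}^2$ from $p_1$ to $p_2$ with property (1). If a path $(\beta^*(s),q(s,\cdot))$, $s\in[0,1]$, in $\mathbb{C}$ is a geodesic, then its baseline $\beta^*$ is a $p$-optimal curve (for some linear isometric map $\mathcal{T}$ between the tangent planes at its endpoints, namely the one induced by $\beta^*$): it is a shortest curve among those from $\beta^*(0)$ to $\beta^*(1)$ that induce the same parallel transport map. -/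

import Mathlib

open MeasureTheory Set
open scoped ContDiff

noncomputable section

/-- Ambient Euclidean space `ℝ³`. -/
abbrev E3 : Type := EuclideanSpace ℝ (Fin 3)

/-- The unit sphere `𝕊²` in `ℝ³`. -/
def S2 : Set E3 := Metric.sphere 0 1

/-- The tangent plane `T_x(𝕊²) = x^⊥` at a point `x` of the sphere, with the Euclidean metric. -/
abbrev tangentPlane (x : E3) : Submodule ℝ E3 := (ℝ ∙ x)ᗮ

/-- The orthogonal projection of `ℝ³` onto `T_x(𝕊²)`. -/
def tangentProj (x : E3) : E3 →L[ℝ] E3 := (tangentPlane x).starProjection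

/-- The parameter interval `[0,1]`. -/
abbrev I01 : Set ℝ := Icc 0 1

/-- `β : [0,1] → 𝕊²` is a smooth curve from `p₁` to `p₂`; values outside `[0,1]` play no role. -/
structure IsSphereCurve (p₁ p₂ : E3) (β : ℝ → E3) : Prop where
  smooth : ContDiffOn ℝ ∞ β I01
  mem_sphere : ∀ s ∈ I01, β s ∈ S2
  source : β 0 = p₁
  target : β 1 = p₂

/-- The velocity at `s ∈ [0,1]` (one-sided at the endpoints). -/
def velocity {F : Type*} [NormedAddCommGroup F] [NormedSpace ℝ F] (c : ℝ → F) (s : ℝ) : F :=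
  derivWithin c I01 s

/-- The length of a curve on the sphere. -/
def curveLength (β : ℝ → E3) : ℝ := ∫ s in (0 : ℝ)..1, ‖velocity β s‖

/-- `V` is a smooth tangent vector field along `β` that is parallel for the Levi-Civita connection
of the sphere, i.e. the tangential part of its derivative vanishes. -/
structure IsParallelAlong (β V : ℝ → E3) : Prop where
  smooth : ContDiffOn ℝ ∞ V I01
  tangent : ∀ s ∈ I01, V s ∈ tangentPlane (β s)
  parallel : ∀ s ∈ I01, tangentProj (β s) (velocity V s) = 0

/-- The parallel transport along `β` (a curve from `p₁` to `p₂`) is the map `T`. -/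
def InducesTransport {p₁ p₂ : E3} (β : ℝ → E3)
    (T : tangentPlane p₁ →ₗᵢ[ℝ] tangentPlane p₂) : Prop :=
  ∀ v : tangentPlane p₁, ∃ V : ℝ → E3, IsParallelAlong β V ∧ V 0 = v ∧ V 1 = T v

/-- `β` is `p`-optimal for the linear isometry `T : T_{p₁}(𝕊²) → T_{p₂}(𝕊²)`: it is a curve from
`p₁` to `p₂` whose parallel transport is `T`, and it is the shortest amongst all such curves. -/
structure IsPOptimalFor {p₁ p₂ : E3} (T : tangentPlane p₁ →ₗᵢ[ℝ] tangentPlane p₂)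
    (β : ℝ → E3) : Prop where
  curve : IsSphereCurve p₁ p₂ β
  transport : InducesTransport β T
  shortest : ∀ γ : ℝ → E3, IsSphereCurve p₁ p₂ γ → InducesTransport γ T →
    curveLength β ≤ curveLength γ

/-- `β` is a `p`-optimal curve: it is `p`-optimal for some linear isometry between the tangent
planes at its endpoints (necessarily the one induced by `β`). -/
def IsPOptimal (β : ℝ → E3) : Prop :=
  ∃ T : tangentPlane (β 0) →ₗᵢ[ℝ] tangentPlane (β 1), IsPOptimalFor T β

/-- The Hilbert space `L²([0,1], ℝ³)`. -/
abbrev L2E3 : Type := Lp E3 2 ((volume : Measure ℝ).restrict I01)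

/-- The vector bundle `ℂ = ∐_{x ∈ 𝕊²} L²([0,1], T_x(𝕊²))`, as a subset of
`ℝ³ × L²([0,1], ℝ³)`. -/
def trajBundle : Set (E3 × L2E3) :=
  {z | z.1 ∈ S2 ∧ ∀ᵐ t ∂((volume : Measure ℝ).restrict I01), z.2 t ∈ tangentPlane z.1}

/-- `s ↦ (β s, q s)`, `s ∈ [0,1]`, is a smooth path in the bundle. -/
structure IsBundlePath (β : ℝ → E3) (q : ℝ → L2E3) : Prop where
  smooth_base : ContDiffOn ℝ ∞ β I01
  smooth_fibre : ContDiffOn ℝ ∞ q I01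
  mem_bundle : ∀ s ∈ I01, (β s, q s) ∈ trajBundle

/-- The covariant derivative `∇_{β_s} q (s, ·)` along `β`: for each `t`, the tangential part of
the `s`-derivative. -/
def covDeriv (β : ℝ → E3) (q : ℝ → L2E3) (s : ℝ) : L2E3 :=
  (tangentProj (β s)).compLp (velocity q s)

/-- The length of a path in the bundle for the Riemannian metric
`⟨(u₁, w₁), (u₂, w₂)⟩ = u₁ · u₂ + ∫₀¹ w₁ · w₂ dt`, the velocity being `(β_s, ∇_{β_s} q)`. -/
def bundleLength (β : ℝ → E3) (q : ℝ → L2E3) : ℝ :=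
  ∫ s in (0 : ℝ)..1, Real.sqrt (‖velocity β s‖ ^ 2 + ‖covDeriv β q s‖ ^ 2)

/-- `(β, q)` is a geodesic of the bundle: a shortest smooth path between its endpoints. -/
structure IsBundleGeodesic (β : ℝ → E3) (q : ℝ → L2E3) : Prop where
  path : IsBundlePath β q
  shortest : ∀ (γ : ℝ → E3) (r : ℝ → L2E3), IsBundlePath γ r →
    γ 0 = β 0 → r 0 = q 0 → γ 1 = β 1 → r 1 = q 1 →
    bundleLength β q ≤ bundleLength γ r

end

/-!
Parallel transport along the baseline `β` identifies all fibres of the bundle with the one over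
`p₁`, and in such a parallel frame the covariant derivative of `q` becomes the ordinary derivative
of a path `a` in a fixed Hilbert space. The length of `(β, q)` is therefore `∫ √(‖β'‖² + ‖a'‖²)`,
which by Minkowski's inequality is at least `√(ℓ(β)² + ‖a 1 - a 0‖²)`. Over any other curve `γ`
with the same endpoints and the same parallel transport, the segment from `a 0` to `a 1`, traversed
at a speed almost proportional to `‖γ'‖`, gives a path with the endpoints of `(β, q)` and of length
at most `√((ℓ(γ) + ε)² + ‖a 1 - a 0‖²)`. Minimality of `(β, q)` gives `ℓ(β) ≤ ℓ(γ) + ε`.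
-/

section LinearODE

variable {E : Type*} [NormedAddCommGroup E] [NormedSpace ℝ E] {A : ℝ → E →L[ℝ] E} {a b C : ℝ}

theorem exists_hasDerivWithinAt_Icc_of_Icc {f : ℝ → E → E} {m : ℝ} (ham : a ≤ m) (hmb : m ≤ b)
    {V W : ℝ → E} (hV : ∀ t ∈ Icc a m, HasDerivWithinAt V (f t (V t)) (Icc a m) t)
    (hW : ∀ t ∈ Icc m b, HasDerivWithinAt W (f t (W t)) (Icc m b) t) (hVW : V m = W m) :
    ∃ U : ℝ → E, U a = V a ∧ ∀ t ∈ Icc a b, HasDerivWithinAt U (f t (U t)) (Icc a b) t := by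
  let U : ℝ → E := (Iic m).piecewise V W
  have hUV : EqOn U V (Icc a m) := fun t ht => piecewise_eq_of_mem _ _ _ ht.2
  have hUW : EqOn U W (Icc m b) := fun t ht => by
    rcases ht.1.eq_or_lt with rfl | h
    · rw [← hVW, hUV (right_mem_Icc.mpr ham)]
    · exact piecewise_eq_of_notMem _ _ _ (notMem_Iic.mpr h)
  have hleft : ∀ t, HasDerivWithinAt U (f t (U t)) (Icc a m) t := fun t => by
    by_cases ht : t ∈ Icc a m
    · rw [hUV ht]
      exact (hV t ht).congr hUV (hUV ht)
    · exact HasFDerivWithinAt.of_notMem_closure (by rwa [isClosed_Icc.closure_eq])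
  have hright : ∀ t, HasDerivWithinAt U (f t (U t)) (Icc m b) t := fun t => by
    by_cases ht : t ∈ Icc m b
    · rw [hUW ht]
      exact (hW t ht).congr hUW (hUW ht)
    · exact HasFDerivWithinAt.of_notMem_closure (by rwa [isClosed_Icc.closure_eq])
  refine ⟨U, hUV (left_mem_Icc.mpr ham), fun t _ => ?_⟩
  rw [← Icc_union_Icc_eq_Icc ham hmb]
  exact (hleft t).union (hright t)

theorem exists_linearODE_solution_of_norm_mul_le [CompleteSpace E] (hab : a ≤ b)
    (hA : ContinuousOn A (Icc a b)) (hC : ∀ t ∈ Icc a b, ‖A t‖ ≤ C) (hCab : C * (b - a) ≤ 1 / 2)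
    (v : E) :
    ∃ V : ℝ → E, V a = v ∧ ∀ t ∈ Icc a b, HasDerivWithinAt V (A t (V t)) (Icc a b) t := by
  lift C to NNReal using (norm_nonneg _).trans (hC a (left_mem_Icc.mpr hab))
  have hPL : IsPicardLindelof (fun t x => A t x) ⟨a, left_mem_Icc.mpr hab⟩ v ‖v‖₊ 0
      (C * (2 * ‖v‖₊)) C := by
    refine ⟨fun t ht => ?_, fun x _ => hA.clm_apply continuousOn_const, fun t ht x hx => ?_, ?_⟩
    · exact ((A t).lipschitz.weaken (hC t ht)).lipschitzOnWith
    · have hx' : ‖x‖ ≤ 2 * ‖v‖ := by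
        have := norm_le_of_mem_closedBall hx
        rw [coe_nnnorm] at this
        linarith
      exact (A t).le_of_opNorm_le_of_le (hC t ht) hx'
    · rw [max_eq_left (by simpa using hab)]
      push_cast
      have := mul_le_mul_of_nonneg_right hCab (norm_nonneg v)
      linarith
  exact hPL.exists_eq_forall_mem_Icc_hasDerivWithinAt₀

-- The step length of the local existence theorem depends only on the bound `C` for `‖A‖`, not on
-- the initial value, so finitely many equal steps cover `[a, b]`.
theorem exists_linearODE_solution [CompleteSpace E] (hab : a ≤ b) (hA : ContinuousOn A (Icc a b))
    (v : E) :
    ∃ V : ℝ → E, V a = v ∧ ∀ t ∈ Icc a b, HasDerivWithinAt V (A t (V t)) (Icc a b) t := by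
  obtain ⟨C, hC⟩ := isCompact_Icc.exists_bound_of_continuousOn hA
  obtain ⟨n, hn⟩ := exists_nat_ge (2 * (C * (b - a)))
  replace hn : C * (b - a) ≤ (n + 1) / 2 := by linarith
  induction n generalizing a v with
  | zero => exact exists_linearODE_solution_of_norm_mul_le hab hA hC (by simpa using hn) v
  | succ n ih =>
    set m := a + (b - a) / (n + 2) with hm
    have hma : m - a = (b - a) / (n + 2) := by rw [hm]; ring
    have hbm : b - m = (b - a) * (n + 1) / (n + 2) := by rw [hm]; field_simp; ring
    have ham : a ≤ m := sub_nonneg.mp (hma ▸ by have := sub_nonneg.mpr hab; positivity)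
    have hmb : m ≤ b := sub_nonneg.mp (hbm ▸ by have := sub_nonneg.mpr hab; positivity)
    push_cast at hn
    obtain ⟨V, hVa, hV⟩ := exists_linearODE_solution_of_norm_mul_le ham
      (hA.mono (Icc_subset_Icc_right hmb)) (fun t ht => hC t (Icc_subset_Icc_right hmb ht))
      (by rw [hma, mul_div_assoc', div_le_iff₀ (by positivity)]; linarith) v
    obtain ⟨W, hWm, hW⟩ := ih hmb (hA.mono (Icc_subset_Icc_left ham)) (V m)
      (fun t ht => hC t (Icc_subset_Icc_left ham ht)) (by
        rw [hbm, mul_div_assoc', div_le_iff₀ (by positivity)]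
        nlinarith)
    rw [← hVa]
    exact exists_hasDerivWithinAt_Icc_of_Icc ham hmb hV hW hWm.symm

theorem linearODE_solution_unique (hA : ContinuousOn A (Icc a b)) {V W : ℝ → E}
    (hV : ∀ t ∈ Icc a b, HasDerivWithinAt V (A t (V t)) (Icc a b) t)
    (hW : ∀ t ∈ Icc a b, HasDerivWithinAt W (A t (W t)) (Icc a b) t) (hVW : V a = W a) :
    EqOn V W (Icc a b) := by
  obtain ⟨C, hC⟩ := isCompact_Icc.exists_bound_of_continuousOn hA
  have hsub : ∀ t ∈ Icc a b, HasDerivWithinAt (V - W) (A t ((V - W) t)) (Icc a b) t :=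
    fun t ht => by simpa only [Pi.sub_apply, map_sub] using (hV t ht).sub (hW t ht)
  have hzero := eq_zero_of_abs_deriv_le_mul_abs_self_of_eq_zero_right
    (HasDerivWithinAt.continuousOn hsub)
    (fun t ht => (hsub t (Ico_subset_Icc_self ht)).mono_of_mem_nhdsWithin
      (Icc_mem_nhdsGE_of_mem ht))
    (sub_eq_zero.mpr hVW) (fun t ht => (A t).le_of_opNorm_le (hC t (Ico_subset_Icc_self ht)) _)
  exact fun t ht => sub_eq_zero.mp (hzero t ht)

theorem exists_fundamentalSolution [CompleteSpace E] (hab : a ≤ b)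
    (hA : ContDiffOn ℝ ∞ A (Icc a b)) :
    ∃ R : ℝ → E →L[ℝ] E, ContDiffOn ℝ ∞ R (Icc a b) ∧ R a = ContinuousLinearMap.id ℝ E ∧
      ∀ t ∈ Icc a b, HasDerivWithinAt R (A t ∘L R t) (Icc a b) t := by
  obtain ⟨R, hRa, hR⟩ := exists_linearODE_solution hab
    ((ContinuousLinearMap.compL ℝ E E E).continuous.comp_continuousOn hA.continuousOn)
    (ContinuousLinearMap.id ℝ E)
  refine ⟨R, ?_, hRa, hR⟩
  refine ODE.contDiffOn_enat_Icc_of_hasDerivWithinAt (n := ⊤) (u := univ)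
    (f := fun t S => A t ∘L S) ?_ hR (mapsTo_univ _ _)
  exact (hA.comp contDiffOn_fst fun _ hx => hx.1).clm_comp contDiffOn_snd

end LinearODE

theorem norm_eq_of_inner_deriv_eq_zero {E : Type*} [NormedAddCommGroup E] [InnerProductSpace ℝ E]
    {a b : ℝ} {V V' : ℝ → E} (hV : ∀ t ∈ Icc a b, HasDerivWithinAt V (V' t) (Icc a b) t)
    (horth : ∀ t ∈ Icc a b, inner ℝ (V t) (V' t) = 0) {s : ℝ} (hs : s ∈ Icc a b) :
    ‖V s‖ = ‖V a‖ := by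
  have hsq : ∀ t ∈ Icc a b, HasDerivWithinAt (fun t => ‖V t‖ ^ 2) 0 (Icc a b) t := fun t ht => by
    simpa [horth t ht] using (hV t ht).norm_sq
  have hconst := constant_of_derivWithin_zero (fun t ht => (hsq t ht).differentiableWithinAt)
    (fun t ht => (hsq t (Ico_subset_Icc_self ht)).derivWithin
      (uniqueDiffOn_Icc (ht.1.trans_lt ht.2) t (Ico_subset_Icc_self ht))) s hs
  exact (sq_eq_sq₀ (norm_nonneg _) (norm_nonneg _)).mp hconst

section Velocity

variable {F : Type*} [NormedAddCommGroup F] [NormedSpace ℝ F] {c : ℝ → F} {s : ℝ}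

theorem contDiffOn_velocity (hc : ContDiffOn ℝ ∞ c I01) : ContDiffOn ℝ ∞ (velocity c) I01 :=
  hc.derivWithin uniqueDiffOn_Icc_zero_one (by simp)

theorem hasDerivWithinAt_velocity (hc : ContDiffOn ℝ ∞ c I01) (hs : s ∈ I01) :
    HasDerivWithinAt c (velocity c s) I01 s :=
  (hc.differentiableOn (by simp) s hs).hasDerivWithinAt

theorem velocity_eq {c' : F} (h : HasDerivWithinAt c c' I01 s) (hs : s ∈ I01) :
    velocity c s = c' :=
  h.derivWithin (uniqueDiffOn_Icc_zero_one s hs)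

theorem velocity_mem {K : Submodule ℝ F} (hK : IsClosed (K : Set F)) (hc : ∀ s ∈ I01, c s ∈ K)
    (s : ℝ) : velocity c s ∈ K := by
  have hspan := range_derivWithin_subset_closure_span_image c
    (s := I01) (t := I01) (by simp) (mem_range_self s)
  exact closure_minimal (Submodule.span_le.mpr (image_subset_iff.mpr hc)) hK hspan

theorem norm_sub_le_integral_norm_velocity [CompleteSpace F] (hc : ContDiffOn ℝ 1 c I01) :
    ‖c 1 - c 0‖ ≤ ∫ s in (0 : ℝ)..1, ‖velocity c s‖ := by
  rw [← intervalIntegral.integral_derivWithin_Icc_of_contDiffOn_Icc hc zero_le_one]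
  exact intervalIntegral.norm_integral_le_integral_norm zero_le_one

end Velocity

section AmbientTransport

variable {E : Type*} [NormedAddCommGroup E] [InnerProductSpace ℝ E]

/-- The skew-symmetric operator `x ↦ ⟪β, x⟫ β' - ⟪β', x⟫ β` rotating in the plane of `β` and `β'`.
Along a curve on the unit sphere it generates a flow of ambient isometries which carries the curve
along and restricts to parallel transport on the tangent spaces. -/
noncomputable def transportGenerator (β : ℝ → E) (s : ℝ) : E →L[ℝ] E :=
  (innerSL ℝ (β s)).smulRight (velocity β s) - (innerSL ℝ (velocity β s)).smulRight (β s)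

theorem transportGenerator_apply (β : ℝ → E) (s : ℝ) (x : E) :
    transportGenerator β s x = inner ℝ (β s) x • velocity β s - inner ℝ (velocity β s) x • β s :=
  rfl

theorem inner_transportGenerator_self (β : ℝ → E) (s : ℝ) (x : E) :
    inner ℝ x (transportGenerator β s x) = 0 := by
  rw [transportGenerator_apply, inner_sub_right, real_inner_smul_right, real_inner_smul_right,
    real_inner_comm x, real_inner_comm x]
  ring

theorem contDiffOn_transportGenerator {β : ℝ → E} (hβ : ContDiffOn ℝ ∞ β I01) :
    ContDiffOn ℝ ∞ (transportGenerator β) I01 := by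
  have hinner {c : ℝ → E} (hc : ContDiffOn ℝ ∞ c I01) :
      ContDiffOn ℝ ∞ (fun s => innerSL ℝ (c s)) I01 :=
    (innerSL ℝ (E := E)).contDiff.comp_contDiffOn hc
  have hv := contDiffOn_velocity hβ
  exact ((hinner hβ).smulRight hv).sub ((hinner hv).smulRight hβ)

/-- `R` is the flow of `transportGenerator β`, started at the identity. -/
structure IsAmbientTransport (β : ℝ → E) (R : ℝ → E →L[ℝ] E) : Prop where
  smooth : ContDiffOn ℝ ∞ R I01
  zero : R 0 = ContinuousLinearMap.id ℝ E
  hasDeriv : ∀ s ∈ I01, HasDerivWithinAt R (transportGenerator β s ∘L R s) I01 s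

theorem exists_isAmbientTransport [CompleteSpace E] {β : ℝ → E} (hβ : ContDiffOn ℝ ∞ β I01) :
    ∃ R, IsAmbientTransport β R := by
  obtain ⟨R, hR, hR0, hR'⟩ :=
    exists_fundamentalSolution zero_le_one (contDiffOn_transportGenerator hβ)
  exact ⟨R, hR, hR0, hR'⟩

namespace IsAmbientTransport

variable {β : ℝ → E} {R : ℝ → E →L[ℝ] E} {s : ℝ}

theorem hasDeriv_apply (hR : IsAmbientTransport β R) (x : E) (hs : s ∈ I01) :
    HasDerivWithinAt (fun t => R t x) (transportGenerator β s (R s x)) I01 s :=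
  (ContinuousLinearMap.apply ℝ E x).hasFDerivAt.comp_hasDerivWithinAt s (hR.hasDeriv s hs)

theorem norm_map (hR : IsAmbientTransport β R) (hs : s ∈ I01) (x : E) : ‖R s x‖ = ‖x‖ := by
  have h := norm_eq_of_inner_deriv_eq_zero (fun t ht => hR.hasDeriv_apply x ht)
    (fun t _ => inner_transportGenerator_self β t (R t x)) hs
  simpa only [hR.zero, ContinuousLinearMap.id_apply] using h

theorem inner_map_map (hR : IsAmbientTransport β R) (hs : s ∈ I01) (x y : E) :
    inner ℝ (R s x) (R s y) = inner ℝ x y :=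
  (LinearMap.norm_map_iff_inner_map_map (R s)).mp (hR.norm_map hs) x y

theorem eq_map_of_hasDeriv (hR : IsAmbientTransport β R) (hβ : ContDiffOn ℝ ∞ β I01) {V : ℝ → E}
    (hV : ∀ t ∈ I01, HasDerivWithinAt V (transportGenerator β t (V t)) I01 t) (hs : s ∈ I01) :
    V s = R s (V 0) :=
  linearODE_solution_unique (contDiffOn_transportGenerator hβ).continuousOn hV
    (fun _ ht => hR.hasDeriv_apply (V 0) ht) (by simp [hR.zero]) hs

theorem comp_adjoint [FiniteDimensional ℝ E] (hR : IsAmbientTransport β R) (hs : s ∈ I01) :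
    R s ∘L (R s).adjoint = ContinuousLinearMap.id ℝ E := by
  have hadj : ((R s).adjoint : E →ₗ[ℝ] E) * (R s : E →ₗ[ℝ] E) = 1 :=
    congrArg ContinuousLinearMap.toLinearMap
      ((R s).norm_map_iff_adjoint_comp_self.mp (hR.norm_map hs))
  exact ContinuousLinearMap.coe_injective (mul_eq_one_comm.mp hadj)

end IsAmbientTransport

section UnitCurve

variable {β V : ℝ → E} {R : ℝ → E →L[ℝ] E} {s : ℝ}

theorem inner_velocity_add_inner_velocity {r : ℝ} (hβ : ContDiffOn ℝ ∞ β I01)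
    (hV : ContDiffOn ℝ ∞ V I01) (hβV : ∀ t ∈ I01, inner ℝ (β t) (V t) = r) (hs : s ∈ I01) :
    inner ℝ (β s) (velocity V s) + inner ℝ (velocity β s) (V s) = 0 :=
  (uniqueDiffOn_Icc_zero_one s hs).eq_deriv _
    ((hasDerivWithinAt_velocity hβ hs).inner ℝ (hasDerivWithinAt_velocity hV hs))
    ((hasDerivWithinAt_const s I01 r).congr hβV (hβV s hs))

theorem inner_velocity_eq_zero (hβ : ContDiffOn ℝ ∞ β I01) (hunit : ∀ t ∈ I01, ‖β t‖ = 1)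
    (hs : s ∈ I01) : inner ℝ (β s) (velocity β s) = 0 := by
  have h := inner_velocity_add_inner_velocity (r := 1) hβ hβ
    (fun t ht => by rw [real_inner_self_eq_norm_sq, hunit t ht, one_pow]) hs
  rw [real_inner_comm (β s)] at h
  exact add_self_eq_zero.mp h

theorem IsAmbientTransport.map_source (hR : IsAmbientTransport β R) (hβ : ContDiffOn ℝ ∞ β I01)
    (hunit : ∀ t ∈ I01, ‖β t‖ = 1) (hs : s ∈ I01) : R s (β 0) = β s := by
  refine (hR.eq_map_of_hasDeriv hβ (fun t ht => ?_) hs).symm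
  have h := hasDerivWithinAt_velocity hβ ht
  rwa [transportGenerator_apply, real_inner_self_eq_norm_sq, hunit t ht, one_pow, one_smul,
    real_inner_comm, inner_velocity_eq_zero hβ hunit ht, zero_smul, sub_zero]

theorem starProjection_transportGenerator (β : ℝ → E) (s : ℝ) {x : E} (hx : x ∈ (ℝ ∙ β s)ᗮ) :
    (ℝ ∙ β s)ᗮ.starProjection (transportGenerator β s x) = 0 := by
  rw [transportGenerator_apply, Submodule.mem_orthogonal_singleton_iff_inner_right.mp hx,
    zero_smul, zero_sub, map_neg, map_smul,
    Submodule.starProjection_orthogonalComplement_singleton_eq_zero, smul_zero, neg_zero]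

theorem transportGenerator_eq_velocity (hβ : ContDiffOn ℝ ∞ β I01) (hunit : ∀ t ∈ I01, ‖β t‖ = 1)
    (hV : ContDiffOn ℝ ∞ V I01) (htan : ∀ t ∈ I01, V t ∈ (ℝ ∙ β t)ᗮ) (hs : s ∈ I01)
    (hpar : (ℝ ∙ β s)ᗮ.starProjection (velocity V s) = 0) :
    transportGenerator β s (V s) = velocity V s := by
  have horth : ∀ t ∈ I01, inner ℝ (β t) (V t) = 0 :=
    fun t ht => Submodule.mem_orthogonal_singleton_iff_inner_right.mp (htan t ht)
  have hnormal : inner ℝ (β s) (velocity V s) • β s = velocity V s := by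
    rw [← Submodule.starProjection_unit_singleton ℝ (hunit s hs)]
    rw [Submodule.starProjection_orthogonal] at hpar
    exact (sub_eq_zero.mp hpar).symm
  rw [transportGenerator_apply, horth s hs, zero_smul, zero_sub, ← neg_smul, ← hnormal,
    eq_neg_of_add_eq_zero_left (inner_velocity_add_inner_velocity hβ hV horth hs)]

end UnitCurve

end AmbientTransport

section SphereCurve

variable {p₁ p₂ : E3} {β V : ℝ → E3} {R : ℝ → E3 →L[ℝ] E3} {s : ℝ}

namespace IsSphereCurve

theorem norm_eq_one (hβ : IsSphereCurve p₁ p₂ β) : ∀ t ∈ I01, ‖β t‖ = 1 :=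
  fun t ht => mem_sphere_zero_iff_norm.mp (hβ.mem_sphere t ht)

theorem transport_source (hβ : IsSphereCurve p₁ p₂ β) (hR : IsAmbientTransport β R)
    (hs : s ∈ I01) : R s p₁ = β s :=
  hβ.source ▸ hR.map_source hβ.smooth hβ.norm_eq_one hs

theorem transport_mem_tangentPlane (hβ : IsSphereCurve p₁ p₂ β) (hR : IsAmbientTransport β R)
    (hs : s ∈ I01) {v : E3} (hv : v ∈ tangentPlane p₁) : R s v ∈ tangentPlane (β s) := by
  rw [Submodule.mem_orthogonal_singleton_iff_inner_right] at hv ⊢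
  rwa [← hβ.transport_source hR hs, hR.inner_map_map hs]

theorem adjoint_transport_mem_tangentPlane (hβ : IsSphereCurve p₁ p₂ β)
    (hR : IsAmbientTransport β R) (hs : s ∈ I01) {v : E3} (hv : v ∈ tangentPlane (β s)) :
    (R s).adjoint v ∈ tangentPlane p₁ := by
  rw [Submodule.mem_orthogonal_singleton_iff_inner_right] at hv ⊢
  rwa [ContinuousLinearMap.adjoint_inner_right, hβ.transport_source hR hs]

theorem isParallelAlong_transport (hβ : IsSphereCurve p₁ p₂ β) (hR : IsAmbientTransport β R)
    {v : E3} (hv : v ∈ tangentPlane p₁) : IsParallelAlong β (fun s => R s v) where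
  smooth := hR.smooth.clm_apply contDiffOn_const
  tangent _ hs := hβ.transport_mem_tangentPlane hR hs hv
  parallel s hs := by
    rw [velocity_eq (hR.hasDeriv_apply v hs) hs]
    exact starProjection_transportGenerator β s (hβ.transport_mem_tangentPlane hR hs hv)

end IsSphereCurve

theorem IsParallelAlong.eq_transport (hV : IsParallelAlong β V) (hβ : IsSphereCurve p₁ p₂ β)
    (hR : IsAmbientTransport β R) (hs : s ∈ I01) : V s = R s (V 0) := by
  refine hR.eq_map_of_hasDeriv hβ.smooth (fun t ht => ?_) hs
  rw [transportGenerator_eq_velocity hβ.smooth hβ.norm_eq_one hV.smooth hV.tangent ht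
    (hV.parallel t ht)]
  exact hasDerivWithinAt_velocity hV.smooth ht

namespace IsSphereCurve

theorem inducesTransport_iff (hβ : IsSphereCurve p₁ p₂ β) (hR : IsAmbientTransport β R)
    {T : tangentPlane p₁ →ₗᵢ[ℝ] tangentPlane p₂} :
    InducesTransport β T ↔ ∀ v, (T v : E3) = R 1 v := by
  refine ⟨fun h v => ?_, fun h v => ?_⟩
  · obtain ⟨V, hV, hV0, hV1⟩ := h v
    rw [← hV1, ← hV0]
    exact hV.eq_transport hβ hR unitInterval.one_mem
  · exact ⟨_, hβ.isParallelAlong_transport hR v.2, by simp [hR.zero], (h v).symm⟩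

theorem exists_inducesTransport (hβ : IsSphereCurve p₁ p₂ β) :
    ∃ T : tangentPlane p₁ →ₗᵢ[ℝ] tangentPlane p₂, InducesTransport β T := by
  obtain ⟨R, hR⟩ := exists_isAmbientTransport hβ.smooth
  have hmaps : ∀ v ∈ tangentPlane p₁, R 1 v ∈ tangentPlane p₂ := fun _ hv =>
    hβ.target ▸ hβ.transport_mem_tangentPlane hR unitInterval.one_mem hv
  let T : tangentPlane p₁ →ₗᵢ[ℝ] tangentPlane p₂ :=
    ⟨(R 1).toLinearMap.restrict hmaps, fun v => hR.norm_map unitInterval.one_mem v⟩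
  exact ⟨T, (hβ.inducesTransport_iff hR).mpr fun _ => rfl⟩

end IsSphereCurve

end SphereCurve

section CompLp

open ContinuousLinearMap

variable {α E F G : Type*} [NormedAddCommGroup E] [NormedSpace ℝ E] [NormedAddCommGroup F]
  [NormedSpace ℝ F] [NormedAddCommGroup G] [NormedSpace ℝ G] {m : MeasurableSpace α}
  {p : ENNReal} {μ : Measure α}

theorem comp_compLp (A : F →L[ℝ] G) (B : E →L[ℝ] F) (z : Lp E p μ) :
    (A ∘L B).compLp z = A.compLp (B.compLp z) := by
  ext1
  filter_upwards [(A ∘L B).coeFn_compLp z, A.coeFn_compLp (B.compLp z), B.coeFn_compLp z]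
    with t hAB hA hB
  rw [hAB, hA, hB, comp_apply]

theorem id_compLp (z : Lp E p μ) : (ContinuousLinearMap.id ℝ E).compLp z = z := by
  ext1
  filter_upwards [(ContinuousLinearMap.id ℝ E).coeFn_compLp z] with t ht
  rw [ht, id_apply]

theorem compLp_add (A : E →L[ℝ] F) (z w : Lp E p μ) :
    A.compLp (z + w) = A.compLp z + A.compLp w :=
  (A.compLpₗ p μ).map_add z w

theorem norm_compLp_of_norm_map {A : E →L[ℝ] F} (hA : ∀ x, ‖A x‖ = ‖x‖) (z : Lp E p μ) :
    ‖A.compLp z‖ = ‖z‖ := by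
  have hnorm : ∀ᵐ t ∂μ, ‖A.compLp z t‖ = ‖z t‖ :=
    (A.coeFn_compLp z).mono fun t ht => by rw [ht, hA]
  rw [Lp.norm_def, Lp.norm_def, eLpNorm_congr_norm_ae hnorm]

section Calculus

variable [Fact (1 ≤ p)] {A : ℝ → E →L[ℝ] F} {z : ℝ → Lp E p μ} {S : Set ℝ}

theorem hasDerivWithinAt_compLp {A' : E →L[ℝ] F} {z' : Lp E p μ} {s : ℝ}
    (hA : HasDerivWithinAt A A' S s) (hz : HasDerivWithinAt z z' S s) :
    HasDerivWithinAt (fun s => (A s).compLp (z s)) (A'.compLp (z s) + (A s).compLp z') S s :=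
  (((ContinuousLinearMap.id ℝ (E →L[ℝ] F)).compLpL₂ p μ).hasFDerivAt.comp_hasDerivWithinAt s
    hA).clm_apply hz

theorem contDiffOn_compLp {n : WithTop ℕ∞} (hA : ContDiffOn ℝ n A S) (hz : ContDiffOn ℝ n z S) :
    ContDiffOn ℝ n (fun s => (A s).compLp (z s)) S :=
  (((ContinuousLinearMap.id ℝ (E →L[ℝ] F)).compLpL₂ p μ).contDiff.comp_contDiffOn hA).clm_apply hz

end Calculus

/-- The subspace `Lᵖ(μ, K)` of `Lᵖ(μ, E)`: the classes of functions with values in `K` almost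
everywhere. -/
def lpFibre (p : ENNReal) (μ : Measure α) (K : Submodule ℝ E) : Submodule ℝ (Lp E p μ) where
  carrier := {z | ∀ᵐ t ∂μ, z t ∈ K}
  add_mem' {z w} hz hw := by
    change ∀ᵐ t ∂μ, (z + w) t ∈ K
    filter_upwards [Lp.coeFn_add z w, hz, hw] with t ht hzt hwt
    exact ht ▸ K.add_mem hzt hwt
  zero_mem' := (Lp.coeFn_zero E p μ).mono fun t ht => ht ▸ K.zero_mem
  smul_mem' r z hz := by
    change ∀ᵐ t ∂μ, (r • z) t ∈ K
    filter_upwards [Lp.coeFn_smul r z, hz] with t ht hzt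
    exact ht ▸ K.smul_mem r hzt

variable {K : Submodule ℝ E} {z : Lp E p μ}

theorem mem_lpFibre : z ∈ lpFibre p μ K ↔ ∀ᵐ t ∂μ, z t ∈ K := Iff.rfl

theorem compLp_mem_lpFibre {L : Submodule ℝ F} {A : E →L[ℝ] F} (hA : ∀ x ∈ K, A x ∈ L)
    (hz : z ∈ lpFibre p μ K) : A.compLp z ∈ lpFibre p μ L := by
  rw [mem_lpFibre] at hz ⊢
  filter_upwards [A.coeFn_compLp z, hz] with t ht hzt
  exact ht ▸ hA _ hzt

theorem compLp_eq_zero_of_mem_lpFibre {A : E →L[ℝ] F} (hA : ∀ x ∈ K, A x = 0)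
    (hz : z ∈ lpFibre p μ K) : A.compLp z = 0 := by
  rw [Lp.eq_zero_iff_ae_eq_zero]
  filter_upwards [A.coeFn_compLp z, hz] with t ht hzt
  exact ht.trans (hA _ hzt)

theorem compLp_congr_of_mem_lpFibre {A B : E →L[ℝ] F} (hAB : ∀ x ∈ K, A x = B x)
    (hz : z ∈ lpFibre p μ K) : A.compLp z = B.compLp z := by
  ext1
  filter_upwards [A.coeFn_compLp z, B.coeFn_compLp z, hz] with t hA hB hzt
  rw [hA, hB, hAB _ hzt]

theorem isClosed_lpFibre {E : Type*} [NormedAddCommGroup E] [InnerProductSpace ℝ E]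
    [Fact (1 ≤ p)] (K : Submodule ℝ E) [K.HasOrthogonalProjection] :
    IsClosed (lpFibre p μ K : Set (Lp E p μ)) := by
  have hfix : (lpFibre p μ K : Set (Lp E p μ)) = {z | K.starProjection.compLp z = z} := by
    ext z
    refine ⟨fun hz => ?_, fun hz => ?_⟩
    · rw [mem_ofPred_eq, compLp_congr_of_mem_lpFibre (B := .id ℝ E)
        (fun x hx => Submodule.starProjection_eq_self_iff.mpr hx) hz, id_compLp]
    · filter_upwards [K.starProjection.coeFn_compLp z] with t ht
      rw [← (hz : K.starProjection.compLp z = z), ht]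
      exact K.starProjection_apply_mem _
  rw [hfix]
  exact isClosed_eq (K.starProjection.compLpL p μ).continuous continuous_id

end CompLp

section Length

open intervalIntegral

theorem sqrt_sq_integral_add_sq_integral_le {μ : Measure ℝ} {a b : ℝ} {u w : ℝ → ℝ} (hab : a ≤ b)
    (hu : IntervalIntegrable u μ a b) (hw : IntervalIntegrable w μ a b) :
    √((∫ s in a..b, u s ∂μ) ^ 2 + (∫ s in a..b, w s ∂μ) ^ 2) ≤
      ∫ s in a..b, √(u s ^ 2 + w s ^ 2) ∂μ := by
  have huC : IntervalIntegrable (fun s => (u s : ℂ)) μ a b := ⟨hu.1.ofReal, hu.2.ofReal⟩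
  have hwC : IntervalIntegrable (fun s => (w s : ℂ)) μ a b := ⟨hw.1.ofReal, hw.2.ofReal⟩
  have hint : ∫ s in a..b, (u s + w s * Complex.I) ∂μ =
      (∫ s in a..b, u s ∂μ : ℝ) + (∫ s in a..b, w s ∂μ : ℝ) * Complex.I := by
    rw [integral_add huC (hwC.mul_const _), intervalIntegral.integral_mul_const,
      integral_ofReal, integral_ofReal]
  calc √((∫ s in a..b, u s ∂μ) ^ 2 + (∫ s in a..b, w s ∂μ) ^ 2)
      = ‖∫ s in a..b, (u s + w s * Complex.I) ∂μ‖ := by rw [hint, Complex.norm_add_mul_I]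
    _ ≤ ∫ s in a..b, ‖(u s + w s * Complex.I : ℂ)‖ ∂μ := norm_integral_le_integral_norm hab
    _ = ∫ s in a..b, √(u s ^ 2 + w s ^ 2) ∂μ := by simp only [Complex.norm_add_mul_I]

theorem exists_velocity_eq_div_integral {g : ℝ → ℝ} (hg : ContDiffOn ℝ ∞ g I01)
    (hg0 : ∫ s in (0 : ℝ)..1, g s ≠ 0) :
    ∃ f : ℝ → ℝ, ContDiffOn ℝ ∞ f I01 ∧ f 0 = 0 ∧ f 1 = 1 ∧
      ∀ s ∈ I01, velocity f s = g s / ∫ t in (0 : ℝ)..1, g t := by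
  set L := ∫ s in (0 : ℝ)..1, g s
  let f : ℝ → ℝ := fun s => (∫ t in (0 : ℝ)..s, g t) / L
  have hf : ∀ s ∈ I01, HasDerivWithinAt f (g s / L) I01 s := fun s hs => by
    have : Fact (s ∈ Icc (0 : ℝ) 1) := ⟨hs⟩
    refine HasDerivWithinAt.div_const (integral_hasDerivWithinAt_right ?_
      (hg.continuousOn.stronglyMeasurableAtFilter_nhdsWithin measurableSet_Icc s)
      (hg.continuousOn s hs)) L
    exact (hg.continuousOn.mono (Icc_subset_Icc_right hs.2)).intervalIntegrable_of_Icc hs.1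
  have hsmooth : ContDiffOn ℝ ∞ f I01 :=
    ODE.contDiffOn_enat_Icc_of_hasDerivWithinAt (n := ⊤) (u := univ) (f := fun t _ => g t / L)
      ((hg.comp contDiffOn_fst fun _ hx => hx.1).div_const L) hf (mapsTo_univ _ _)
  exact ⟨f, hsmooth, by simp [f], div_self hg0, fun s hs => velocity_eq (hf s hs) hs⟩

variable {F : Type*} [NormedAddCommGroup F] {w : ℝ → F} {ε : ℝ}

theorem integral_sqrt_norm_sq_add_sq_le (hw : ContinuousOn w I01) (hε : 0 ≤ ε) :
    ∫ s in (0 : ℝ)..1, √(‖w s‖ ^ 2 + ε ^ 2) ≤ (∫ s in (0 : ℝ)..1, ‖w s‖) + ε := by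
  have hwint := hw.norm.intervalIntegrable_of_Icc zero_le_one (μ := volume)
  calc ∫ s in (0 : ℝ)..1, √(‖w s‖ ^ 2 + ε ^ 2)
      ≤ ∫ s in (0 : ℝ)..1, (‖w s‖ + ε) := by
        refine integral_mono_on zero_le_one
          (((hw.norm.pow 2).add continuousOn_const).sqrt.intervalIntegrable_of_Icc zero_le_one)
          (hwint.add intervalIntegrable_const) fun s _ => ?_
        rw [Real.sqrt_le_left (by positivity), add_sq]
        have : 0 ≤ 2 * ‖w s‖ * ε := by positivity
        linarith
    _ = (∫ s in (0 : ℝ)..1, ‖w s‖) + ε := by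
        rw [integral_add hwint intervalIntegrable_const]
        simp

variable [InnerProductSpace ℝ F]

theorem contDiffOn_sqrt_norm_sq_add_sq {n : WithTop ℕ∞} {S : Set ℝ} (hw : ContDiffOn ℝ n w S)
    (hε : 0 < ε) : ContDiffOn ℝ n (fun s => √(‖w s‖ ^ 2 + ε ^ 2)) S :=
  ((hw.norm_sq ℝ).add contDiffOn_const).sqrt fun _ _ => by positivity

-- The equality case of `sqrt_sq_integral_add_sq_integral_le` is `D * f'` proportional to `‖w‖`;
-- `ε` keeps `f` smooth where `w` vanishes.
theorem exists_integral_sqrt_norm_sq_add_velocity_sq_le (hw : ContDiffOn ℝ ∞ w I01) (hε : 0 < ε)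
    (D : ℝ) :
    ∃ f : ℝ → ℝ, ContDiffOn ℝ ∞ f I01 ∧ f 0 = 0 ∧ f 1 = 1 ∧
      ∫ s in (0 : ℝ)..1, √(‖w s‖ ^ 2 + (D * velocity f s) ^ 2) ≤
        √(((∫ s in (0 : ℝ)..1, ‖w s‖) + ε) ^ 2 + D ^ 2) := by
  set g : ℝ → ℝ := fun s => √(‖w s‖ ^ 2 + ε ^ 2)
  have hg : ContDiffOn ℝ ∞ g I01 := contDiffOn_sqrt_norm_sq_add_sq hw hε
  have hpos : 0 < ∫ s in (0 : ℝ)..1, g s :=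
    intervalIntegral_pos_of_pos (hg.continuousOn.intervalIntegrable_of_Icc zero_le_one)
      (fun s => by positivity) zero_lt_one
  have hle := integral_sqrt_norm_sq_add_sq_le hw.continuousOn hε.le
  obtain ⟨f, hf, hf0, hf1, hfv⟩ := exists_velocity_eq_div_integral hg hpos.ne'
  set L := ∫ s in (0 : ℝ)..1, g s
  refine ⟨f, hf, hf0, hf1, ?_⟩
  have hspeed : ∀ s ∈ I01,
      √(‖w s‖ ^ 2 + (D * velocity f s) ^ 2) ≤ g s * √(1 + (D / L) ^ 2) := fun s hs => by
    rw [hfv s hs, ← Real.sqrt_mul (by positivity)]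
    refine Real.sqrt_le_sqrt ?_
    have hgs : g s ^ 2 = ‖w s‖ ^ 2 + ε ^ 2 := Real.sq_sqrt (by positivity)
    calc ‖w s‖ ^ 2 + (D * (g s / L)) ^ 2 ≤ g s ^ 2 + (D * (g s / L)) ^ 2 := by
          rw [hgs]
          gcongr
          exact le_add_of_nonneg_right (sq_nonneg ε)
      _ = (‖w s‖ ^ 2 + ε ^ 2) * (1 + (D / L) ^ 2) := by rw [← hgs]; ring
  calc ∫ s in (0 : ℝ)..1, √(‖w s‖ ^ 2 + (D * velocity f s) ^ 2)
      ≤ ∫ s in (0 : ℝ)..1, g s * √(1 + (D / L) ^ 2) :=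
        integral_mono_on zero_le_one
          (((hw.continuousOn.norm.pow 2).add
            (((contDiffOn_velocity hf).continuousOn.const_mul D).pow 2)).sqrt
              |>.intervalIntegrable_of_Icc zero_le_one)
          ((hg.continuousOn.mul continuousOn_const).intervalIntegrable_of_Icc zero_le_one) hspeed
    _ = L * √(1 + (D / L) ^ 2) := intervalIntegral.integral_mul_const _ _
    _ = √(L ^ 2 + D ^ 2) := by
        nth_rw 1 [← Real.sqrt_sq hpos.le]
        rw [← Real.sqrt_mul (sq_nonneg L)]
        congr 1
        field_simp
    _ ≤ √(((∫ s in (0 : ℝ)..1, ‖w s‖) + ε) ^ 2 + D ^ 2) := by gcongr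

end Length

/-- The fibre `L²([0,1], T_x(𝕊²))` of the bundle over `x`. -/
noncomputable abbrev tangentFibre (x : E3) : Submodule ℝ L2E3 :=
  lpFibre 2 (volume.restrict I01) (tangentPlane x)

/-- `a` is the coordinate of the bundle path `(β, q)` in the parallel frame `R` along `β`: a path
in the fibre over `p₁` with `q s = R s ∘ a s`. -/
structure IsParallelCoordinate (p₁ : E3) (R : ℝ → E3 →L[ℝ] E3) (q a : ℝ → L2E3) : Prop where
  smooth : ContDiffOn ℝ ∞ a I01
  mem_fibre : ∀ s ∈ I01, a s ∈ tangentFibre p₁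
  compLp_eq : ∀ s ∈ I01, q s = (R s).compLp (a s)

theorem IsBundlePath.isSphereCurve {β : ℝ → E3} {q : ℝ → L2E3} (h : IsBundlePath β q) :
    IsSphereCurve (β 0) (β 1) β :=
  ⟨h.smooth_base, fun s hs => (h.mem_bundle s hs).1, rfl, rfl⟩

namespace IsParallelCoordinate

variable {p₁ p₂ : E3} {β : ℝ → E3} {R : ℝ → E3 →L[ℝ] E3} {q a : ℝ → L2E3} {s : ℝ}

theorem apply_zero (ha : IsParallelCoordinate p₁ R q a) (hR : IsAmbientTransport β R) :
    q 0 = a 0 := by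
  rw [ha.compLp_eq 0 unitInterval.zero_mem, hR.zero, id_compLp]

theorem velocity_mem_fibre (ha : IsParallelCoordinate p₁ R q a) (s : ℝ) :
    velocity a s ∈ tangentFibre p₁ :=
  velocity_mem (isClosed_lpFibre _) ha.mem_fibre s

theorem isBundlePath (ha : IsParallelCoordinate p₁ R q a) (hβ : IsSphereCurve p₁ p₂ β)
    (hR : IsAmbientTransport β R) : IsBundlePath β q where
  smooth_base := hβ.smooth
  smooth_fibre := (contDiffOn_compLp hR.smooth ha.smooth).congr ha.compLp_eq
  mem_bundle s hs := by
    refine ⟨hβ.mem_sphere s hs, mem_lpFibre.mp ?_⟩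
    rw [ha.compLp_eq s hs]
    exact compLp_mem_lpFibre (fun _ => hβ.transport_mem_tangentPlane hR hs) (ha.mem_fibre s hs)

theorem covDeriv_eq (ha : IsParallelCoordinate p₁ R q a) (hβ : IsSphereCurve p₁ p₂ β)
    (hR : IsAmbientTransport β R) (hs : s ∈ I01) :
    covDeriv β q s = (R s).compLp (velocity a s) := by
  have hq := (hasDerivWithinAt_compLp (hR.hasDeriv s hs)
    (hasDerivWithinAt_velocity ha.smooth hs)).congr ha.compLp_eq (ha.compLp_eq s hs)
  have hgen : ∀ v ∈ tangentPlane p₁,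
      (tangentProj (β s) ∘L transportGenerator β s ∘L R s) v = 0 := fun v hv =>
    starProjection_transportGenerator β s (hβ.transport_mem_tangentPlane hR hs hv)
  have htan : ∀ v ∈ tangentPlane p₁, (tangentProj (β s) ∘L R s) v = R s v := fun v hv =>
    Submodule.starProjection_eq_self_iff.mpr (hβ.transport_mem_tangentPlane hR hs hv)
  calc covDeriv β q s
      = (tangentProj (β s) ∘L transportGenerator β s ∘L R s).compLp (a s) +
          (tangentProj (β s) ∘L R s).compLp (velocity a s) := by
        rw [covDeriv, velocity_eq hq hs, compLp_add, ← comp_compLp, ← comp_compLp]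
    _ = (R s).compLp (velocity a s) := by
        rw [compLp_eq_zero_of_mem_lpFibre hgen (ha.mem_fibre s hs),
          compLp_congr_of_mem_lpFibre htan (ha.velocity_mem_fibre s), zero_add]

theorem bundleLength_eq (ha : IsParallelCoordinate p₁ R q a) (hβ : IsSphereCurve p₁ p₂ β)
    (hR : IsAmbientTransport β R) :
    bundleLength β q = ∫ s in (0 : ℝ)..1, √(‖velocity β s‖ ^ 2 + ‖velocity a s‖ ^ 2) := by
  refine intervalIntegral.integral_congr fun s hs => ?_
  rw [uIcc_of_le zero_le_one] at hs
  simp only [ha.covDeriv_eq hβ hR hs, norm_compLp_of_norm_map (hR.norm_map hs)]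

theorem sqrt_curveLength_sq_add_le (ha : IsParallelCoordinate p₁ R q a)
    (hβ : IsSphereCurve p₁ p₂ β) (hR : IsAmbientTransport β R) :
    √(curveLength β ^ 2 + ‖a 1 - a 0‖ ^ 2) ≤ bundleLength β q := by
  have hint {F : Type} [NormedAddCommGroup F] [NormedSpace ℝ F] {c : ℝ → F}
      (hc : ContDiffOn ℝ ∞ c I01) : IntervalIntegrable (fun s => ‖velocity c s‖) volume 0 1 :=
    (contDiffOn_velocity hc).continuousOn.norm.intervalIntegrable_of_Icc zero_le_one
  calc √(curveLength β ^ 2 + ‖a 1 - a 0‖ ^ 2)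
      ≤ √(curveLength β ^ 2 + (∫ s in (0 : ℝ)..1, ‖velocity a s‖) ^ 2) := by
        gcongr
        exact norm_sub_le_integral_norm_velocity (ha.smooth.of_le (by simp))
    _ ≤ ∫ s in (0 : ℝ)..1, √(‖velocity β s‖ ^ 2 + ‖velocity a s‖ ^ 2) :=
        sqrt_sq_integral_add_sq_integral_le zero_le_one (hint hβ.smooth) (hint ha.smooth)
    _ = bundleLength β q := (ha.bundleLength_eq hβ hR).symm

end IsParallelCoordinate

section BundlePath

variable {p₁ p₂ : E3} {β : ℝ → E3} {R : ℝ → E3 →L[ℝ] E3} {q : ℝ → L2E3}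

theorem IsBundlePath.exists_isParallelCoordinate (hq : IsBundlePath β q)
    (hβ : IsSphereCurve p₁ p₂ β) (hR : IsAmbientTransport β R) :
    ∃ a, IsParallelCoordinate p₁ R q a := by
  have hadj : ContDiffOn ℝ ∞ (fun s => (R s).adjoint) I01 :=
    (ContinuousLinearMap.adjoint (𝕜 := ℝ) (E := E3) (F := E3)).toContinuousLinearEquiv.contDiff
      (𝕜 := ℝ) |>.comp_contDiffOn hR.smooth
  refine ⟨fun s => (R s).adjoint.compLp (q s), contDiffOn_compLp hadj hq.smooth_fibre,
    fun s hs => ?_, fun s hs => ?_⟩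
  · exact compLp_mem_lpFibre (fun _ => hβ.adjoint_transport_mem_tangentPlane hR hs)
      (hq.mem_bundle s hs).2
  · rw [← comp_compLp, hR.comp_adjoint hs, id_compLp]

theorem IsSphereCurve.exists_isParallelCoordinate_bundleLength_le (hβ : IsSphereCurve p₁ p₂ β)
    (hR : IsAmbientTransport β R) {b c : L2E3} (hb : b ∈ tangentFibre p₁)
    (hc : c ∈ tangentFibre p₁) {ε : ℝ} (hε : 0 < ε) :
    ∃ q a, IsParallelCoordinate p₁ R q a ∧ a 0 = b ∧ a 1 = c ∧
      bundleLength β q ≤ √((curveLength β + ε) ^ 2 + ‖c - b‖ ^ 2) := by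
  obtain ⟨f, hf, hf0, hf1, hlength⟩ := exists_integral_sqrt_norm_sq_add_velocity_sq_le
    (contDiffOn_velocity hβ.smooth) hε ‖c - b‖
  let a : ℝ → L2E3 := fun s => b + f s • (c - b)
  have ha : IsParallelCoordinate p₁ R (fun s => (R s).compLp (a s)) a :=
    ⟨contDiffOn_const.add (hf.smul contDiffOn_const),
      fun s _ => add_mem hb (Submodule.smul_mem _ _ (sub_mem hc hb)), fun _ _ => rfl⟩
  have hspeed : ∀ s ∈ I01, ‖velocity a s‖ ^ 2 = (‖c - b‖ * velocity f s) ^ 2 := fun s hs => by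
    rw [velocity_eq (((hasDerivWithinAt_velocity hf hs).smul_const (c - b)).const_add b) hs,
      norm_smul, Real.norm_eq_abs, mul_comm, mul_pow, sq_abs, mul_pow]
  refine ⟨_, a, ha, by simp [a, hf0], by simp [a, hf1], ?_⟩
  rw [ha.bundleLength_eq hβ hR]
  refine le_of_eq_of_le (intervalIntegral.integral_congr fun s hs => ?_) hlength
  rw [uIcc_of_le zero_le_one] at hs
  simp only [hspeed s hs]

end BundlePath

theorem curveLength_nonneg (β : ℝ → E3) : 0 ≤ curveLength β :=
  intervalIntegral.integral_nonneg zero_le_one fun _ _ => norm_nonneg _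

theorem IsParallelCoordinate.exists_isBundlePath_of_inducesTransport {p₁ p₂ : E3} {β γ : ℝ → E3}
    {R : ℝ → E3 →L[ℝ] E3} {q a : ℝ → L2E3} {T : tangentPlane p₁ →ₗᵢ[ℝ] tangentPlane p₂}
    (ha : IsParallelCoordinate p₁ R q a) (hR : IsAmbientTransport β R)
    (hβ : IsSphereCurve p₁ p₂ β) (hβT : InducesTransport β T)
    (hγ : IsSphereCurve p₁ p₂ γ) (hγT : InducesTransport γ T) {ε : ℝ} (hε : 0 < ε) :
    ∃ r, IsBundlePath γ r ∧ r 0 = q 0 ∧ r 1 = q 1 ∧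
      bundleLength γ r ≤ √((curveLength γ + ε) ^ 2 + ‖a 1 - a 0‖ ^ 2) := by
  obtain ⟨S, hS⟩ := exists_isAmbientTransport hγ.smooth
  have hSR : ∀ v ∈ tangentPlane p₁, S 1 v = R 1 v := fun v hv =>
    ((hγ.inducesTransport_iff hS).mp hγT ⟨v, hv⟩).symm.trans
      ((hβ.inducesTransport_iff hR).mp hβT ⟨v, hv⟩)
  have ha1 := ha.mem_fibre 1 unitInterval.one_mem
  obtain ⟨r, d, hd, hd0, hd1, hr⟩ := hγ.exists_isParallelCoordinate_bundleLength_le hS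
    (ha.mem_fibre 0 unitInterval.zero_mem) ha1 hε
  refine ⟨r, hd.isBundlePath hγ hS, ?_, ?_, hr⟩
  · rw [hd.apply_zero hS, hd0, ha.apply_zero hR]
  · rw [hd.compLp_eq 1 unitInterval.one_mem, hd1, compLp_congr_of_mem_lpFibre hSR ha1,
      ha.compLp_eq 1 unitInterval.one_mem]

theorem IsBundleGeodesic.isPOptimalFor {p₁ p₂ : E3} {β : ℝ → E3} {q : ℝ → L2E3}
    {T : tangentPlane p₁ →ₗᵢ[ℝ] tangentPlane p₂} (h : IsBundleGeodesic β q)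
    (hβ : IsSphereCurve p₁ p₂ β) (hT : InducesTransport β T) : IsPOptimalFor T β := by
  refine ⟨hβ, hT, fun γ hγ hγT => le_of_forall_pos_le_add fun ε hε => ?_⟩
  obtain ⟨R, hR⟩ := exists_isAmbientTransport hβ.smooth
  obtain ⟨a, ha⟩ := h.path.exists_isParallelCoordinate hβ hR
  obtain ⟨r, hγr, hr0, hr1, hr⟩ :=
    ha.exists_isBundlePath_of_inducesTransport hR hβ hT hγ hγT hε
  have hsqrt : √(curveLength β ^ 2 + ‖a 1 - a 0‖ ^ 2) ≤
      √((curveLength γ + ε) ^ 2 + ‖a 1 - a 0‖ ^ 2) :=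
    calc √(curveLength β ^ 2 + ‖a 1 - a 0‖ ^ 2)
        ≤ bundleLength β q := ha.sqrt_curveLength_sq_add_le hβ hR
      _ ≤ bundleLength γ r := h.shortest γ r hγr (hγ.source.trans hβ.source.symm) hr0
          (hγ.target.trans hβ.target.symm) hr1
      _ ≤ √((curveLength γ + ε) ^ 2 + ‖a 1 - a 0‖ ^ 2) := hr
  rw [Real.sqrt_le_sqrt_iff (by positivity), add_le_add_iff_right] at hsqrt
  exact le_of_sq_le_sq hsqrt (add_nonneg (curveLength_nonneg γ) hε.le)

theorem lemma1 (β : ℝ → E3) (q : ℝ → L2E3) (h : IsBundleGeodesic β q) : IsPOptimal β := by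
  have hβ := h.path.isSphereCurve
  obtain ⟨T, hT⟩ := hβ.exists_inducesTransport
  exact ⟨T, h.isPOptimalFor hβ hT⟩
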